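/- For a topological space $X$ let $CL(X)$ be the set of all nonempty closed subsets of $X$, and let $\mathbb V$ be the Vietoris topology on $CL(X)$, i.e. the topology generated by the sets $$\langle U_1,\dots,U_k\rangle=\Big\{H\in CL(X): H\subseteq \bigcup_{i=1}^k U_i \text{ and } H\cap U_j\neq\emptyset \text{ for } 1\le j\le k\Big\},$$ where $k\ge 1$ and $U_1,\dots,U_k$ are open in $X$. Let $S(X)$ be the set of all non-isolated points of $X$. A topological space $(Y,\tau)$ is a $\gamma$-space if there is a function $g:\omega\times Y\to\tau$ such that (i) for each $y\in Y$, $\{g(n,y):n\in\omega\}$ is a base of neighborhoods at $y$; and (ii) for each $n\in\omega$ and $y\in Y$ there is $m\in\omega$ such that $z\in g(m,y)$ implies $g(m,z)\subseteq g(n,y)$. Theorem. Let $X$ be a regular $T_1$ (that is, $T_3$) space. Then $(CL(X),\mathbb V)$ is a $\gamma$-space if and only if $X$ is separable and metrizable and $S(X)$ is compact. -/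

import Mathlib

/-- The set `CL(X)` of all nonempty closed subsets of a topological space `X`. -/
def CL (X : Type*) [TopologicalSpace X] : Type _ :=
  {H : Set X // H.Nonempty ∧ IsClosed H}

namespace CL

/-- The set `⟨U₁, …, U_k⟩` of all nonempty closed `H` with `H ⊆ U₁ ∪ ⋯ ∪ U_k` which meet
every `U_j`. -/
def box {X : Type*} [TopologicalSpace X] {k : ℕ} (U : Fin k → Set X) : Set (CL X) :=
  {H | H.1 ⊆ ⋃ i, U i ∧ ∀ i, (H.1 ∩ U i).Nonempty}

/-- The Vietoris topology on `CL(X)`: it is generated by the sets `⟨U₁, …, U_k⟩` with `k ≥ 1` and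
`U₁, …, U_k` open in `X`. -/
instance vietorisTopology (X : Type*) [TopologicalSpace X] : TopologicalSpace (CL X) :=
  TopologicalSpace.generateFrom
    {W | ∃ (k : ℕ) (U : Fin k → Set X), 0 < k ∧ (∀ i, IsOpen (U i)) ∧ W = box U}

/-- This is the topology that `CL(X)` inherits from Mathlib's Vietoris topology on the powerset. -/
theorem vietorisTopology_eq_induced (X : Type*) [TopologicalSpace X] :
    vietorisTopology X =
      TopologicalSpace.induced (fun H : CL X => H.1) (TopologicalSpace.vietoris X) := by
  apply le_antisymm
  · rw [TopologicalSpace.vietoris, induced_generateFrom_eq]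
    refine le_generateFrom ?_
    rintro _ ⟨_, ⟨U, hU, rfl⟩ | ⟨U, hU, rfl⟩, rfl⟩
    · refine TopologicalSpace.isOpen_generateFrom_of_mem
        ⟨1, fun _ => U, one_pos, fun _ => hU, ?_⟩
      ext H
      simp only [Set.mem_preimage, Set.mem_powerset_iff, box, Set.mem_ofPred_eq,
        Set.iUnion_const]
      exact ⟨fun h => ⟨h, fun _ => by rw [Set.inter_eq_left.2 h]; exact H.2.1⟩, fun h => h.1⟩
    · refine TopologicalSpace.isOpen_generateFrom_of_mem
        ⟨2, ![U, Set.univ], two_pos, fun i => ?_, ?_⟩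
      · fin_cases i
        · exact hU
        · exact isOpen_univ
      · ext H
        simp only [Set.mem_preimage, box, Set.mem_ofPred_eq, Fin.forall_fin_two]
        refine ⟨fun h => ⟨fun x _ => Set.mem_iUnion.2 ⟨1, trivial⟩, h, ?_⟩, fun h => h.2.1⟩
        simpa using H.2.1
  · refine le_generateFrom ?_
    rintro _ ⟨k, U, -, hU, rfl⟩
    let _ := TopologicalSpace.vietoris X
    refine ⟨{s | s ⊆ ⋃ i, U i} ∩ ⋂ i, {s | (s ∩ U i).Nonempty}, ?_, ?_⟩
    · exact (isOpen_iUnion hU).powerset_vietoris.inter (isOpen_iInter_of_finite fun i =>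
        TopologicalSpace.vietoris.isOpen_inter_nonempty_of_isOpen (hU i))
    · ext H
      simp [box]

end CL

/-- A `γ`-space: there is a map `g` from `ω × X` to the topology such that the sets `g n x`,
`n ∈ ω`, form a base at `x`, and for all `n`, `x` there is `m` with `g m y ⊆ g n x` for every
`y ∈ g m x`. -/
def IsGammaSpace (X : Type*) [TopologicalSpace X] : Prop :=
  ∃ g : ℕ → X → Set X,
    (∀ n x, IsOpen (g n x)) ∧
    (∀ x, (nhds x).HasBasis (fun _ : ℕ => True) (fun n => g n x)) ∧
    (∀ n x, ∃ m, ∀ y ∈ g m x, g m y ⊆ g n x)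

/-- The set `S(X)` of non-isolated points of `X`. -/
def nonisolatedPoints (X : Type*) [TopologicalSpace X] : Set X :=
  {x | ¬ IsOpen ({x} : Set X)}

/-!
Suppose that `CL X` is a `γ`-space. Then it is first countable, and three things follow for `X`.
Finite sets being dense in the hyperspace, every closed subset of `X` is separable
(`CL.exists_countable_dense_subset`); in particular `X` has only countably many isolated points.
The set `S` of non-isolated points is countably compact, since a closed discrete sequence in `S`
would be a point of `CL X` without a countable neighbourhood base
(`exists_mapClusterPt_of_mem_nonisolatedPoints`). And `X`, embedded in `CL X` by singletons, is
itself a `γ`-space. For a countably compact `S` the `γ`-property yields a development, whose stars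
at the points of a countable dense subset of `S`, together with the isolated singletons, form a
countable base of `X` (`secondCountableTopology_of_isGammaSpace`). Urysohn's theorem makes `X`
metrizable, and then `S` is sequentially compact, hence compact.

Conversely, let `X` be separable and metrizable with `S` compact. Give `X` a totally bounded metric
and let `CL.gammaNhd ε H` consist of the `L` with `L ⊆ H ∪ thickening ε (H ∩ S)` and
`H ⊆ thickening ε L`. These sets are neighbourhoods of `H` because the metric is totally bounded
and the points of `H` outside `S` are isolated, they form a base at `H` because `H ∩ S` is compact,
and the triangle inequality (`CL.gammaNhd_trans`) gives the `γ`-property with `ε / 2` for `ε`.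
-/

open Set Filter Topology TopologicalSpace Metric

/-! ### The Vietoris topology on `CL X` -/

namespace CL

variable {X : Type*} [TopologicalSpace X]

/-- A nonempty closed set as a point of `CL X`. -/
def of (H : Set X) (hne : H.Nonempty) (hc : IsClosed H) : CL X := ⟨H, hne, hc⟩

theorem isOpen_setOf_subset {U : Set X} (hU : IsOpen U) : IsOpen {H : CL X | H.1 ⊆ U} := by
  rw [vietorisTopology_eq_induced]
  exact ⟨_, hU.powerset_vietoris, rfl⟩

theorem isOpen_setOf_inter_nonempty {U : Set X} (hU : IsOpen U) :
    IsOpen {H : CL X | (H.1 ∩ U).Nonempty} := by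
  rw [vietorisTopology_eq_induced]
  exact ⟨_, TopologicalSpace.vietoris.isOpen_inter_nonempty_of_isOpen hU, rfl⟩

/-- Convergence in the Vietoris topology is tested on the subbase of "hit" and "miss" sets. -/
theorem tendsto_nhds {α : Type*} {l : Filter α} {f : α → CL X} {H : CL X}
    (hsub : ∀ U, IsOpen U → H.1 ⊆ U → ∀ᶠ a in l, (f a).1 ⊆ U)
    (hhit : ∀ U, IsOpen U → (H.1 ∩ U).Nonempty → ∀ᶠ a in l, ((f a).1 ∩ U).Nonempty) :
    Tendsto f l (𝓝 H) := by
  rw [vietorisTopology_eq_induced, @nhds_induced _ _ (TopologicalSpace.vietoris X),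
    tendsto_comap_iff, TopologicalSpace.vietoris, tendsto_nhds_generateFrom_iff]
  rintro _ (⟨U, hU, rfl⟩ | ⟨U, hU, rfl⟩) hH
  · exact hsub U hU hH
  · exact hhit U hU hH

theorem isInducing_singleton [T1Space X] :
    IsInducing (fun x : X => of {x} (singleton_nonempty x) isClosed_singleton) := by
  refine isInducing_iff_nhds.2 fun x => le_antisymm ?_ fun U hU => ?_
  · refine (tendsto_nhds (fun U hU hx => ?_) fun U hU hx => ?_).le_comap
    · filter_upwards [hU.mem_nhds (hx rfl)] with y hy using singleton_subset_iff.2 hy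
    · obtain ⟨_, rfl, hxU⟩ := hx
      filter_upwards [hU.mem_nhds hxU] with y hy using ⟨y, rfl, hy⟩
  · obtain ⟨V, hVU, hV, hxV⟩ := mem_nhds_iff.1 hU
    refine ⟨_, (isOpen_setOf_subset hV).mem_nhds (singleton_subset_iff.2 hxV), fun y hy => ?_⟩
    exact hVU (hy rfl)

/-- Adding one point to a closed set `H` is continuous in that point; when the point lies in `H`
nothing is added. -/
theorem tendsto_insert [T1Space X] (H : CL X) {x : X} (hx : x ∈ H.1) :
    Tendsto (fun y => of ({y} ∪ H.1) ((singleton_nonempty y).inl) (isClosed_singleton.union H.2.2))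
      (𝓝 x) (𝓝 H) := by
  refine tendsto_nhds (fun U hU hH => ?_) fun U hU hH => Eventually.of_forall fun y => ?_
  · filter_upwards [hU.mem_nhds (hH hx)] with y hy using union_subset (singleton_subset_iff.2 hy) hH
  · exact hH.mono (inter_subset_inter_left _ subset_union_right)

/-- If `CL X` is first countable then every closed subset of `X` is separable: each of countably
many basic neighbourhoods of `H` contains a finite subset of `H`. -/
theorem exists_countable_dense_subset [T1Space X] [FirstCountableTopology (CL X)] {H : Set X}
    (hH : IsClosed H) : ∃ D : Set X, D.Countable ∧ D ⊆ H ∧ H ⊆ closure D := by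
  rcases H.eq_empty_or_nonempty with rfl | hne
  · exact ⟨∅, countable_empty, Subset.rfl, empty_subset _⟩
  obtain ⟨N, hN⟩ := (𝓝 (of H hne hH)).exists_antitone_basis
  have key : ∀ n, ∃ F : Set X, F.Finite ∧ F ⊆ H ∧ ∃ L ∈ N n, L.1 = F := by
    intro n
    -- Finite subsets of `H` are dense among all subsets; the empty one is excluded by the open
    -- condition `hne'`.
    have h1 : H ∈ @closure _ (TopologicalSpace.vietoris X) {t : Set X | t.Finite ∧ t ⊆ H} := by
      rw [TopologicalSpace.vietoris.closure_finite_subsets]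
      exact subset_closure
    have h2 := hN.mem n
    rw [vietorisTopology_eq_induced, @nhds_induced _ _ (TopologicalSpace.vietoris X)] at h2
    obtain ⟨W, hW, hWN⟩ := h2
    let _ := TopologicalSpace.vietoris X
    have hne' : {t : Set X | (t ∩ univ).Nonempty} ∈ 𝓝 H :=
      (TopologicalSpace.vietoris.isOpen_inter_nonempty_of_isOpen isOpen_univ).mem_nhds
        (by simpa using hne)
    obtain ⟨F, ⟨hFW, hFne⟩, hF, hFH⟩ := mem_closure_iff_nhds.1 h1 _ (inter_mem hW hne')
    exact ⟨F, hF, hFH, of F (by simpa using hFne) hF.isClosed, hWN hFW, rfl⟩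
  choose F hF hFH L hLN hLF using key
  refine ⟨⋃ n, F n, countable_iUnion fun n => (hF n).countable, iUnion_subset hFH, fun x hx => ?_⟩
  refine mem_closure_iff.2 fun U hU hxU => ?_
  obtain ⟨n, hn⟩ := hN.mem_iff.1
    ((isOpen_setOf_inter_nonempty hU).mem_nhds (show (H ∩ U).Nonempty from ⟨x, hx, hxU⟩))
  obtain ⟨y, hy, hyU⟩ : ((L n).1 ∩ U).Nonempty := hn (hLN n)
  exact ⟨y, hyU, mem_iUnion.2 ⟨n, hLF n ▸ hy⟩⟩

end CL

/-! ### Countable compactness of the set of non-isolated points -/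

theorem isClosed_nonisolatedPoints (X : Type*) [TopologicalSpace X] :
    IsClosed (nonisolatedPoints X) := by
  rw [← isOpen_compl_iff, isOpen_iff_mem_nhds]
  intro x hx
  have hx : IsOpen {x} := not_not.1 hx
  refine mem_of_superset (hx.mem_nhds rfl) ?_
  rintro _ rfl
  exact not_not.2 hx

/-- If `CL X` is first countable, then the set of non-isolated points of the `T₃` space `X` is
countably compact. A sequence `u` of non-isolated points without cluster point would have a closed
discrete range `A`. Given a countable base at `A`, choose `y n ∉ A` so close to `u n` that
`A ∪ {y n}` belongs to the `n`-th basic set; if the `y n` do not accumulate at `A`, the complement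
of their closure is a neighbourhood of `A` which contains no basic one. -/
theorem exists_mapClusterPt_of_mem_nonisolatedPoints {X : Type*} [TopologicalSpace X] [T3Space X]
    [FirstCountableTopology (CL X)] {u : ℕ → X} (hu : ∀ n, u n ∈ nonisolatedPoints X) :
    ∃ x ∈ nonisolatedPoints X, MapClusterPt x atTop u := by
  suffices h : ∃ x, MapClusterPt x atTop u by
    obtain ⟨x, hx⟩ := h
    refine ⟨x, (isClosed_nonisolatedPoints X).closure_eq ▸ mem_closure_iff_nhds.2 fun V hV => ?_, hx⟩
    obtain ⟨n, hn⟩ := (mapClusterPt_iff_frequently.1 hx V hV).exists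
    exact ⟨u n, hn, hu n⟩
  by_contra! hcl
  have hfin : LocallyFinite (fun n => ({u n} : Set X)) := by
    intro x
    have h := hcl x
    rw [mapClusterPt_iff_frequently] at h
    push Not at h
    obtain ⟨V, hV, hVu⟩ := h
    refine ⟨V, hV, ?_⟩
    rw [← Nat.cofinite_eq_atTop] at hVu
    simpa [Filter.Eventually, mem_cofinite, compl_ofPred] using hVu
  -- As `u` has no cluster point, it takes every value only finitely often.
  have hfib : ∀ k, {n | u n = u k}.Finite := fun k =>
    (hfin.point_finite (u k)).subset fun n hn => by simpa using Eq.symm hn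
  let A : CL X := ⟨range u, range_nonempty u, by
    simpa [iUnion_singleton_eq_range] using hfin.isClosed_iUnion fun n => isClosed_singleton⟩
  obtain ⟨N, hN⟩ := (𝓝 A).exists_antitone_basis
  -- Regularity separates `u n` from the other values of `u`, which form a closed set.
  have hV : ∀ n, ∃ V ∈ 𝓝 (u n), IsClosed V ∧ ∀ j, u j ∈ V → u j = u n := by
    intro n
    have hB : IsClosed (⋃ j : {j // u j ≠ u n}, ({u j} : Set X)) :=
      (hfin.comp_injective Subtype.val_injective).isClosed_iUnion fun _ => isClosed_singleton
    obtain ⟨V, hV, hVc, hVB⟩ := exists_mem_nhds_isClosed_subset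
      (hB.isOpen_compl.mem_nhds (x := u n) (by simp))
    refine ⟨V, hV, hVc, fun j hj => by_contra fun hne => hVB hj ?_⟩
    exact mem_iUnion.2 ⟨⟨j, hne⟩, rfl⟩
  choose V hVu hVc hVA using hV
  -- Avoiding the earlier `V j` replaces a choice of disjoint neighbourhoods of the points of `A`.
  have hy : ∀ n, ∃ y, y ≠ u n ∧ y ∈ V n ∧ (∀ j < n, u j ≠ u n → y ∉ V j) ∧
      CL.of ({y} ∪ A.1) ((singleton_nonempty y).inl) (isClosed_singleton.union A.2.2) ∈ N n := by
    intro n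
    have : (𝓝[≠] (u n)).NeBot := ⟨fun h => hu n (isOpen_singleton_iff_punctured_nhds _ |>.2 h)⟩
    have h1 : ∀ᶠ y in 𝓝 (u n), ∀ j ∈ Finset.range n, u j ≠ u n → y ∉ V j := by
      refine (Filter.eventually_all_finset _).2 fun j _ => ?_
      by_cases hj : u j = u n
      · exact .of_forall fun y h => absurd hj h
      · filter_upwards [(hVc j).isOpen_compl.mem_nhds (x := u n)
          fun h => hj (hVA j n h).symm] with y hy _ using hy
    have h2 := (A.tendsto_insert (x := u n) (mem_range_self n)).eventually_mem (hN.mem n)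
    obtain ⟨y, ⟨⟨hyN, hyj⟩, hyV⟩, hyu⟩ := (((h2.and h1).and (hVu n)).filter_mono
      nhdsWithin_le_nhds |>.and (self_mem_nhdsWithin (a := u n) (s := {u n}ᶜ))).exists
    exact ⟨y, hyu, hyV, fun j hj => hyj j (Finset.mem_range.2 hj), hyN⟩
  choose y hyu hyV hyj hyN using hy
  have hyA : ∀ n k, y n ≠ u k := fun n k h =>
    hyu n (h.trans (hVA n k (h ▸ hyV n)))
  have hAy : A.1 ⊆ (closure (range y))ᶜ := by
    rintro _ ⟨k, rfl⟩ hk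
    have hF : {n | y n ∈ V k}.Finite := by
      refine ((finite_Iic k).union (hfib k)).subset fun n hn => ?_
      by_contra! h
      simp only [mem_union, mem_Iic, mem_ofPred_eq, not_or, not_le] at h
      exact hyj n k h.1 (Ne.symm h.2) hn
    have hW : (y '' {n | y n ∈ V k})ᶜ ∈ 𝓝 (u k) :=
      (hF.image y).isClosed.isOpen_compl.mem_nhds fun ⟨n, _, hn⟩ => hyA n k hn
    obtain ⟨_, ⟨h1, h2⟩, n, rfl⟩ := mem_closure_iff_nhds.1 hk _ (inter_mem (hVu k) hW)
    exact h2 ⟨n, h1, rfl⟩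
  obtain ⟨n, hn⟩ := hN.mem_iff.1
    ((CL.isOpen_setOf_subset isClosed_closure.isOpen_compl).mem_nhds hAy)
  exact hn (hyN n) (.inl rfl) (subset_closure (mem_range_self n))

/-! ### `γ`-spaces -/

namespace IsGammaSpace

variable {X Y : Type*} [TopologicalSpace X] [TopologicalSpace Y]

/-- In the definition of a `γ`-space the sets `g n x` need only be neighbourhoods of `x`. -/
theorem of_nhds {g : ℕ → X → Set X} (hb : ∀ x, (𝓝 x).HasBasis (fun _ : ℕ => True) (fun n => g n x))
    (hg : ∀ n x, ∃ m, ∀ y ∈ g m x, g m y ⊆ g n x) : IsGammaSpace X := by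
  refine ⟨fun n x => interior (g n x), fun _ _ => isOpen_interior, fun x => ⟨fun U => ?_⟩,
    fun n x => ?_⟩
  · refine ⟨fun hU => ?_, fun ⟨n, _, hn⟩ => ?_⟩
    · obtain ⟨n, -, hn⟩ := (hb x).mem_iff.1 hU
      exact ⟨n, trivial, interior_subset.trans hn⟩
    · exact mem_of_superset (interior_mem_nhds.2 ((hb x).mem_of_mem trivial)) hn
  · obtain ⟨m, hm⟩ := hg n x
    exact ⟨m, fun y hy => interior_mono (hm y (interior_subset hy))⟩

theorem of_isInducing (h : IsGammaSpace Y) {f : X → Y} (hf : IsInducing f) : IsGammaSpace X := by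
  obtain ⟨g, ho, hb, hg⟩ := h
  refine ⟨fun n x => f ⁻¹' g n (f x), fun n x => (ho n _).preimage hf.continuous, fun x => ?_,
    fun n x => ?_⟩
  · rw [hf.nhds_eq_comap]
    exact (hb _).comap f
  · obtain ⟨m, hm⟩ := hg n (f x)
    exact ⟨m, fun y hy => preimage_mono (hm _ hy)⟩

theorem firstCountableTopology (h : IsGammaSpace X) : FirstCountableTopology X := by
  obtain ⟨g, -, hb, -⟩ := h
  exact ⟨fun x => (hb x).isCountablyGenerated⟩

/-- The neighbourhood assignment of a `γ`-space can be chosen decreasing in `n`. -/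
theorem exists_antitone (h : IsGammaSpace X) : ∃ g : ℕ → X → Set X,
    (∀ n x, g n x ∈ 𝓝 x) ∧ (∀ n x, IsOpen (g n x)) ∧ (∀ x, ∀ U ∈ 𝓝 x, ∃ n, g n x ⊆ U) ∧
    (∀ x, Antitone fun n => g n x) ∧ (∀ n x, ∃ m, ∀ y ∈ g m x, g m y ⊆ g n x) := by
  obtain ⟨g, ho, hb, hg⟩ := h
  choose m hm using hg
  refine ⟨fun n x => ⋂ i ∈ Finset.range (n + 1), g i x, fun n x => ?_, fun n x => ?_,
    fun x U hU => ?_, fun x a b hab => ?_, fun n x => ?_⟩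
  · exact (Filter.biInter_finset_mem _).2 fun i _ => (hb x).mem_of_mem trivial
  · exact isOpen_biInter_finset fun i _ => ho i x
  · obtain ⟨n, -, hn⟩ := (hb x).mem_iff.1 hU
    exact ⟨n, (biInter_subset_of_mem (Finset.self_mem_range_succ n)).trans hn⟩
  · exact biInter_subset_biInter_left fun i hi => by
      exact Finset.range_mono (Nat.succ_le_succ hab) hi
  · refine ⟨(Finset.range (n + 1)).sup fun i => m i x, fun y hy => subset_iInter₂ fun i hi => ?_⟩
    have hi' : m i x ∈ Finset.range ((Finset.range (n + 1)).sup (fun i => m i x) + 1) :=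
      Finset.mem_range_succ_iff.2 (Finset.le_sup (f := fun i => m i x) hi)
    exact (biInter_subset_of_mem hi').trans (hm i x y (mem_iInter₂.1 hy _ hi'))

end IsGammaSpace

/-- A Hausdorff `γ`-space is second countable if it is the union of a separable, countably compact
set `K` and of countably many isolated points. The `γ`-property and countable compactness make the
families `{g n a | a ∈ K}` a development at every point, and even iterated stars with respect to
them shrink to points of `K`; so the stars of a countable dense subset of `K` form a base at the
points of `K`. -/
theorem secondCountableTopology_of_isGammaSpace {X : Type*} [TopologicalSpace X] [T2Space X]
    (hX : IsGammaSpace X) {K D : Set X} (hD : D.Countable) (hKD : K ⊆ closure D)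
    (hK : ∀ u : ℕ → X, (∀ n, u n ∈ K) → ∃ x ∈ K, MapClusterPt x atTop u)
    (hKc : Kᶜ.Countable) (hKo : ∀ x ∉ K, IsOpen {x}) : SecondCountableTopology X := by
  obtain ⟨g, hgn, hgo, hgb, hga, hg⟩ := hX.exists_antitone
  -- If `c` is a cluster point of `a`, some set `g n (a n)` lies in any given neighbourhood of `c`.
  have hclus : ∀ (a : ℕ → X) (c : X), MapClusterPt c atTop a → ∀ U ∈ 𝓝 c, ∀ N, ∃ n ≥ N,
      g n (a n) ⊆ U := by
    intro a c hc U hU N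
    obtain ⟨k, hk⟩ := hgb c U hU
    obtain ⟨m, hm⟩ := hg k c
    obtain ⟨n, hn, hnm⟩ := ((mapClusterPt_iff_frequently.1 hc _ (hgn m c)).and_eventually
      (eventually_ge_atTop (max m N))).exists
    exact ⟨n, (le_max_right _ _).trans hnm,
      ((hga _ ((le_max_left _ _).trans hnm)).trans (hm _ hn)).trans hk⟩
  -- The families `{g n a | a ∈ K}` form a development.
  have hdev : ∀ p, ∀ U ∈ 𝓝 p, ∃ n, ∀ a ∈ K, p ∈ g n a → g n a ⊆ U := by
    intro p U hU
    by_contra! h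
    choose a haK hpa haU using h
    obtain ⟨c, -, hc⟩ := hK a haK
    have hcp : p = c := by
      by_contra hne
      obtain ⟨n, -, hn⟩ := hclus a c hc _ (isOpen_compl_singleton.mem_nhds (Ne.symm hne)) 0
      exact hn (hpa n) rfl
    obtain ⟨n, -, hn⟩ := hclus a c hc U (hcp ▸ hU) 0
    exact haU n hn
  -- The star of `x` with respect to the family `{g n a | a ∈ K}`.
  let St : ℕ → X → Set X := fun n x => ⋃ a ∈ {a ∈ K | x ∈ g n a}, g n a
  -- Stars of points close to `p` are small as well.
  have hstar : ∀ p, ∀ U ∈ 𝓝 p, ∃ n, ∀ x, p ∈ St n x → St n x ⊆ U := by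
    intro p U hU
    by_contra! h
    choose x hpx hxU using h
    have hb : ∀ n, ∃ b ∈ K, x n ∈ g n b ∧ p ∈ g n b := by
      intro n
      simpa [St, and_assoc] using hpx n
    have ha : ∀ n, ∃ a ∈ K, x n ∈ g n a ∧ ¬ g n a ⊆ U := by
      intro n
      simpa [St, and_assoc] using hxU n
    choose b hbK hxb hpb using hb
    choose a haK hxa haU using ha
    obtain ⟨c, -, hc⟩ := hK a haK
    have hcp : p = c := by
      by_contra hne
      obtain ⟨V, W, hV, hW, hpV, hcW, hVW⟩ := t2_separation hne
      obtain ⟨N, hN⟩ := hdev p V (hV.mem_nhds hpV)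
      obtain ⟨n, hn, hnW⟩ := hclus a c hc W (hW.mem_nhds hcW) N
      refine hVW.le_bot ⟨hN (b n) (hbK n) (hga _ hn (hpb n)) (hga _ hn (hxb n)), hnW (hxa n)⟩
    obtain ⟨n, -, hn⟩ := hclus a c hc U (hcp ▸ hU) 0
    exact haU n hn
  have hbasis : IsTopologicalBasis
      ((fun q : ℕ × X => St q.1 q.2) '' (univ ×ˢ D) ∪ (fun x => {x}) '' Kᶜ) := by
    refine isTopologicalBasis_of_isOpen_of_nhds ?_ fun p U hpU hU => ?_
    · rintro _ (⟨⟨n, x⟩, -, rfl⟩ | ⟨x, hx, rfl⟩)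
      · exact isOpen_biUnion fun a _ => hgo n a
      · exact hKo x hx
    · by_cases hp : p ∈ K
      · obtain ⟨n, hn⟩ := hstar p U (hU.mem_nhds hpU)
        obtain ⟨d, hdg, hdD⟩ := mem_closure_iff_nhds.1 (hKD hp) _ (hgn n p)
        have hpd : p ∈ St n d := mem_biUnion (x := p) ⟨hp, hdg⟩ (mem_of_mem_nhds (hgn n p))
        exact ⟨_, .inl ⟨(n, d), ⟨trivial, hdD⟩, rfl⟩, hpd, hn d hpd⟩
      · exact ⟨{p}, .inr ⟨p, hp, rfl⟩, rfl, singleton_subset_iff.2 hpU⟩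
  exact hbasis.secondCountableTopology
    (((countable_univ.prod hD).image _).union (hKc.image _))

/-! ### The `γ`-property of the hyperspace -/

/-- A separable metrizable space has a totally bounded metric, namely the one induced by an
embedding into the Hilbert cube. -/
theorem exists_metricSpace_totallyBounded (X : Type*) [t : TopologicalSpace X] [SeparableSpace X]
    [MetrizableSpace X] : ∃ m : MetricSpace X,
      m.toUniformSpace.toTopologicalSpace = t ∧ TotallyBounded (univ : Set X) := by
  -- Forgetting that `Y` is the Hilbert cube keeps the product uniformity of `ℕ → unitInterval`
  -- from competing with the uniformity of the chosen metric.
  obtain ⟨Y, _, _, f, hf⟩ :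
      ∃ (Y : Type) (_ : MetricSpace Y) (_ : CompactSpace Y) (f : X → Y), IsEmbedding f := by
    let _ : MetricSpace X := metrizableSpaceMetric X
    obtain ⟨f, hf⟩ := Metric.PiNatEmbed.exists_embedding_to_hilbert_cube (X := X)
    exact ⟨ℕ → unitInterval, metrizableSpaceMetric _, inferInstance, f, hf⟩
  let m : MetricSpace X := hf.comapMetricSpace f
  have hi : Isometry f := hf.to_isometry
  exact ⟨m, rfl, totallyBounded_preimage hi.isUniformInducing isCompact_univ.totallyBounded⟩

namespace CL

variable {X : Type*} [MetricSpace X]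

/-- The set of all closed `L` that lie in `H` except for points `ε`-close to a non-isolated point
of `H`, and whose `ε`-thickening covers `H`. The first condition leaves the isolated points of `H`
unthickened: `H` need not be compact, so a whole thickening of `H` could fail to be small. -/
def gammaNhd (ε : ℝ) (H : CL X) : Set (CL X) :=
  {L | L.1 ⊆ H.1 ∪ thickening ε (H.1 ∩ nonisolatedPoints X) ∧ H.1 ⊆ thickening ε L.1}

theorem gammaNhd_mono {ε δ : ℝ} (h : ε ≤ δ) (H : CL X) : gammaNhd ε H ⊆ gammaNhd δ H :=
  fun _ hL => ⟨hL.1.trans (union_subset_union_right _ (thickening_mono h _)),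
    hL.2.trans (thickening_mono h _)⟩

/-- The key point is that a non-isolated point of `L` is `ε`-close to a non-isolated point of `H`,
whichever of the two parts of `H ∪ thickening ε (H ∩ S)` it lies in. -/
theorem gammaNhd_trans {ε δ : ℝ} (hε : 0 < ε) (hδ : 0 ≤ δ) {H L M : CL X}
    (hL : L ∈ gammaNhd ε H) (hM : M ∈ gammaNhd δ L) : M ∈ gammaNhd (ε + δ) H := by
  have hS : L.1 ∩ nonisolatedPoints X ⊆ thickening ε (H.1 ∩ nonisolatedPoints X) := by
    rintro x ⟨hx, hxS⟩
    rcases hL.1 hx with h | h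
    exacts [self_subset_thickening hε _ ⟨h, hxS⟩, h]
  refine ⟨hM.1.trans (union_subset (hL.1.trans ?_) ?_), hL.2.trans ?_⟩
  · exact union_subset_union_right _ (thickening_mono (le_add_of_nonneg_right hδ) _)
  · rw [add_comm]
    exact ((thickening_subset_of_subset δ hS).trans (thickening_thickening_subset _ _ _)).trans
      subset_union_right
  · exact (thickening_subset_of_subset ε hM.2).trans (thickening_thickening_subset _ _ _)

/-- By total boundedness, `H ⊆ thickening ε L` holds for all `L` in a neighbourhood of `H`: it
suffices that `L` hits the finitely many balls of radius `ε / 2` about an `ε / 2`-net of `H`. -/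
theorem gammaNhd_mem_nhds (hX : TotallyBounded (univ : Set X)) {ε : ℝ} (hε : 0 < ε) (H : CL X) :
    gammaNhd ε H ∈ 𝓝 H := by
  have hopen : IsOpen (H.1 ∪ thickening ε (H.1 ∩ nonisolatedPoints X)) := by
    refine isOpen_iff_mem_nhds.2 fun x hx => ?_
    by_cases hxt : x ∈ thickening ε (H.1 ∩ nonisolatedPoints X)
    · exact mem_of_superset (isOpen_thickening.mem_nhds hxt) subset_union_right
    · have hxH : x ∈ H.1 := hx.resolve_right hxt
      have hxi : IsOpen {x} := by_contra fun h => hxt (self_subset_thickening hε _ ⟨hxH, h⟩)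
      exact mem_of_superset (hxi.mem_nhds rfl) (singleton_subset_iff.2 hx)
  obtain ⟨t, htH, ht, hHt⟩ :=
    finite_approx_of_totallyBounded (hX.subset (subset_univ H.1)) (ε / 2) (half_pos hε)
  have hhit : ∀ᶠ L in 𝓝 H, ∀ y ∈ t, (L.1 ∩ ball y (ε / 2)).Nonempty :=
    (eventually_all_finite ht).2 fun y hy => (isOpen_setOf_inter_nonempty isOpen_ball).mem_nhds
      ⟨y, htH hy, mem_ball_self (half_pos hε)⟩
  filter_upwards [(isOpen_setOf_subset hopen).mem_nhds (subset_union_left : H.1 ⊆ _), hhit]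
    with L hL hLt
  refine ⟨hL, fun x hx => ?_⟩
  obtain ⟨y, hy, hxy⟩ := mem_iUnion₂.1 (hHt hx)
  obtain ⟨z, hzL, hzy⟩ := hLt y hy
  refine mem_thickening_iff.2 ⟨z, hzL, ?_⟩
  linarith [dist_triangle_right x z y, mem_ball.1 hxy, mem_ball.1 hzy]

/-- Compactness of the set of non-isolated points makes the sets `gammaNhd ε H` small: an open set
containing `H` contains a thickening of the compact set of non-isolated points of `H`. -/
theorem exists_gammaNhd_subset (hS : IsCompact (nonisolatedPoints X)) {H : CL X} {N : Set (CL X)}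
    (hN : N ∈ 𝓝 H) : ∃ n : ℕ, gammaNhd ((1 / 2 : ℝ) ^ n) H ⊆ N := by
  have hanti : Antitone fun n : ℕ => gammaNhd ((1 / 2 : ℝ) ^ n) H := fun a b hab =>
    gammaNhd_mono (pow_le_pow_of_le_one (by norm_num) (by norm_num) hab) H
  have hb := hasBasis_iInf_principal hanti.directed_ge
  have hmem : ∀ δ > 0, ∀ᶠ L in ⨅ n : ℕ, 𝓟 (gammaNhd ((1 / 2 : ℝ) ^ n) H), L ∈ gammaNhd δ H := by
    intro δ hδ
    obtain ⟨n, hn⟩ := exists_pow_lt_of_lt_one hδ (show (1 / 2 : ℝ) < 1 by norm_num)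
    exact hb.mem_iff.2 ⟨n, trivial, gammaNhd_mono hn.le H⟩
  have hlim : Tendsto id (⨅ n : ℕ, 𝓟 (gammaNhd ((1 / 2 : ℝ) ^ n) H)) (𝓝 H) := by
    refine tendsto_nhds (fun U hU hHU => ?_) fun U hU ⟨x, hxH, hxU⟩ => ?_
    · obtain ⟨δ, hδ, hδU⟩ := (hS.inter_left H.2.2).exists_thickening_subset_open hU
        (inter_subset_left.trans hHU)
      filter_upwards [hmem δ hδ] with L hL using hL.1.trans (union_subset hHU hδU)
    · obtain ⟨δ, hδ, hδU⟩ := Metric.isOpen_iff.1 hU x hxU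
      filter_upwards [hmem δ hδ] with L hL
      obtain ⟨y, hyL, hxy⟩ := mem_thickening_iff.1 (hL.2 hxH)
      exact ⟨y, hyL, hδU (by rwa [mem_ball, dist_comm])⟩
  obtain ⟨n, -, hn⟩ := hb.mem_iff.1 (hlim hN)
  exact ⟨n, hn⟩

end CL

theorem CL.isGammaSpace {X : Type*} [MetricSpace X] (hX : TotallyBounded (univ : Set X))
    (hS : IsCompact (nonisolatedPoints X)) : IsGammaSpace (CL X) := by
  refine IsGammaSpace.of_nhds (g := fun n H => CL.gammaNhd ((1 / 2 : ℝ) ^ n) H)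
    (fun H => ⟨fun N => ⟨fun hN => ?_, fun ⟨n, _, hn⟩ => ?_⟩⟩) fun n H => ⟨n + 1, fun L hL M hM => ?_⟩
  · simpa using CL.exists_gammaNhd_subset hS hN
  · exact mem_of_superset (CL.gammaNhd_mem_nhds hX (by positivity) H) hn
  · have h := CL.gammaNhd_trans (by positivity) (by positivity) hL hM
    rwa [pow_succ, ← mul_add, show (1 / 2 + 1 / 2 : ℝ) = 1 by norm_num, mul_one] at h

/-! ### The characterization -/

theorem theorem5p13 {X : Type*} [TopologicalSpace X] [T3Space X] :
    IsGammaSpace (CL X) ↔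
      TopologicalSpace.SeparableSpace X ∧ TopologicalSpace.MetrizableSpace X ∧
        IsCompact (nonisolatedPoints X) := by
  constructor
  · intro h
    have := h.firstCountableTopology
    have hX : IsGammaSpace X := h.of_isInducing (CL.isInducing_singleton (X := X))
    obtain ⟨D, hD, -, hSD⟩ := CL.exists_countable_dense_subset (isClosed_nonisolatedPoints X)
    obtain ⟨E, hE, -, hXE⟩ := CL.exists_countable_dense_subset (isClosed_univ (X := X))
    have hI : (nonisolatedPoints X)ᶜ.Countable := by
      refine hE.mono fun x hx => ?_
      obtain ⟨y, rfl, hy⟩ := mem_closure_iff.1 (hXE (mem_univ x)) {x} (not_not.1 hx) rfl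
      exact hy
    have hsc : SecondCountableTopology X := secondCountableTopology_of_isGammaSpace hX hD hSD
      (fun u hu => exists_mapClusterPt_of_mem_nonisolatedPoints hu) hI fun x hx => not_not.1 hx
    refine ⟨inferInstance, inferInstance, ?_⟩
    let _ := metrizableSpaceMetric X
    refine IsSeqCompact.isCompact fun u hu => ?_
    obtain ⟨x, hx, hxu⟩ := exists_mapClusterPt_of_mem_nonisolatedPoints hu
    exact ⟨x, hx, hxu.tendsto_subseq⟩
  · rintro ⟨hsep, hmet, hS⟩
    obtain ⟨m, rfl, hX⟩ := exists_metricSpace_totallyBounded X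
    exact CL.isGammaSpace hX hS
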